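/- **Lemma 3.5.** Let $(W,S)$ be a Coxeter system (of arbitrary, possibly infinite, rank), and let $(\Delta,\delta)$ be a building of type $(W,S)$: a set $\Delta$ of chambers in which every $s\in S$ determines an equivalence relation, called $s$-adjacency, whose classes (the panels of type $s$) each contain at least two chambers, together with a map $\delta:\Delta\times\Delta\to W$ such that for every reduced word $f$ over $S$ and all $x,y\in\Delta$ one has $\delta(x,y)=f$ in $W$ if and only if $x$ and $y$ can be joined by a gallery of type $f$. (A gallery of type $s_1\cdots s_k$ is a sequence of chambers $c_0,\dots,c_k$ with $c_{j-1}\ne c_j$ and $c_{j-1}$ $s_j$-adjacent to $c_j$ for all $j$.) View $W$ itself as a building with $w$ and $ws$ $s$-adjacent for $w\in W$, $s\in S$, and with $\delta_W(x,y)=x^{-1}y$. For $X\subseteq W$, an isometry $\alpha:X\to\Delta$ is a map with $\delta(\alpha(x),\alpha(y))=\delta_W(x,y)$ for all $x,y\in X$. An apartment of $\Delta$ is the image of an isometry $W\to\Delta$. For a reflection $r\in W$ (a conjugate of an element of $S$), the wall of $r$ in $W$ is the set of pairs $M_r=\{\{c_1,c_2\}: c_1,c_2\in W \text{ adjacent},\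 rc_1=c_2\}$. A wall in an apartment $\Sigma$ is a set $\Omega=\{\alpha(P):P\in M_r\}$, where $r$ is a reflection and $\alpha$ is an isometry from the set of chambers $\bigcup M_r\subseteq W$ to $\Delta$ with image contained in $\Sigma$; the elements of $\Omega$ are called the panels of $\Omega$. A panel of $\Omega$ is branching if the panel of $\Delta$ containing it has at least three chambers. Let $\Omega$ be a wall in an apartment $\Sigma$ of $\Delta$. If some panel of $\Omega$ is branching, then every panel of $\Omega$ is branching. -/

import Mathlib

/-- A chamber system with set of chambers `C` and index set `I`: every `i : I` determines a
partition of `C`, given here as an equivalence relation, called `i`-adjacency. -/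
structure ChamberSystem (I C : Type*) where
  /-- the equivalence relation of `i`-adjacency -/
  adj : I → Setoid C

namespace ChamberSystem

variable {I C : Type*} (X : ChamberSystem I C)

/-- Two chambers are adjacent if they are `i`-adjacent for some index `i`. -/
def Adjacent (x y : C) : Prop := ∃ i, X.adj i x y

/-- `X.Gallery x f y`: there is a gallery `(c₀, …, c_k)` of type `f = i₁ ⋯ i_k` from `x = c₀` to
`y = c_k`, that is, `c_{j-1}` and `c_j` are distinct and `i_j`-adjacent for all `j`. -/
inductive Gallery : C → List I → C → Prop
  | nil (x : C) : Gallery x [] x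
  | cons {x y z : C} {i : I} {f : List I} (hadj : X.adj i x y) (hne : x ≠ y)
      (h : Gallery y f z) : Gallery x (i :: f) z

/-- The `J`-residue of a chamber `c`: the set of all chambers that can be joined to `c` by a
`J`-gallery. -/
def residue (J : Set I) (c : C) : Set C := {x | ∃ f : List I, (∀ i ∈ f, i ∈ J) ∧ X.Gallery c f x}

/-- A panel (of type `i`) is an `{i}`-residue. -/
def IsPanel (σ : Set C) : Prop := ∃ (i : I) (c : C), σ = X.residue {i} c

/-- The `{i}`-residue of `c` is the part containing `c` of the partition determined by `i`. -/
theorem mem_residue_singleton {i : I} {c x : C} : x ∈ X.residue {i} c ↔ X.adj i c x := by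
  constructor
  · rintro ⟨f, hf, hg⟩
    induction hg with
    | nil x => exact (X.adj i).refl x
    | @cons a b d j g hadj hne h ih =>
      have hj : j = i := hf j (by simp)
      subst hj
      exact (X.adj j).trans hadj (ih fun k hk => hf k (by simp [hk]))
  · intro h
    by_cases hcx : c = x
    · subst hcx
      exact ⟨[], by simp, Gallery.nil c⟩
    · exact ⟨[i], by simp, Gallery.cons h hcx (Gallery.nil x)⟩

end ChamberSystem

/-- A building of type `(W, S)`, where the Coxeter system `(W, S)` is given by `cs` and `S` indexes
the Coxeter generators: a chamber system over `S` in which each panel contains at least two chambers,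
together with a `W`-metric `δ`. A word `f` over `S` is geodesic if and only if it is reduced. -/
structure Building {S W : Type*} [Group W] {M : CoxeterMatrix S} (cs : CoxeterSystem M W)
    (Δ : Type*) extends ChamberSystem S Δ where
  /-- each panel contains at least two chambers -/
  two_le_panel : ∀ σ, toChamberSystem.IsPanel σ → 2 ≤ σ.encard
  /-- the `W`-metric -/
  δ : Δ → Δ → W
  /-- the defining property of the `W`-metric -/
  δ_eq_iff : ∀ f : List S, cs.IsReduced f → ∀ x y : Δ,
    δ x y = cs.wordProd f ↔ toChamberSystem.Gallery x f y

namespace CoxeterSystem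

variable {S W : Type*} [Group W] {M : CoxeterMatrix S} (cs : CoxeterSystem M W)

/-- The chamber system over `S` of a Coxeter system: the chambers are the elements of `W`, and
the part of the partition determined by `s` containing `w` is `{w, ws}`. -/
def chamberSystem : ChamberSystem S W where
  adj i :=
    { r := fun w₁ w₂ => w₂ = w₁ ∨ w₂ = w₁ * cs.simple i
      iseqv :=
        { refl := fun _ => Or.inl rfl
          symm := by
            rintro x y (h | h)
            · exact Or.inl h.symm
            · exact Or.inr (by simp [h])
          trans := by
            rintro x y z (h | h) (h' | h') <;> simp [h, h'] } }

theorem chamberSystem_adj {i : S} {x y : W} :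
    cs.chamberSystem.adj i x y ↔ y = x ∨ y = x * cs.simple i := Iff.rfl

theorem self_ne_mul_simple (i : S) (x : W) : x ≠ x * cs.simple i := by
  intro h
  exact cs.length_mul_simple_ne x i (congrArg cs.length h.symm)

theorem chamberSystem_gallery_iff {f : List S} {x y : W} :
    cs.chamberSystem.Gallery x f y ↔ y = x * cs.wordProd f := by
  constructor
  · intro h
    induction h with
    | nil x => simp
    | cons hadj hne _ ih =>
      rcases hadj with h | h
      · exact absurd h.symm hne
      · rw [ih, h, cs.wordProd_cons, mul_assoc]
  · induction f generalizing x with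
    | nil => rintro rfl; simpa using ChamberSystem.Gallery.nil x
    | cons i f ih =>
      intro h
      exact ChamberSystem.Gallery.cons (Or.inr rfl) (cs.self_ne_mul_simple i x)
        (ih (by rw [h, cs.wordProd_cons, mul_assoc]))

/-- The Coxeter group `W`, viewed as a building of type `(W, S)` with `W`-metric
`δ_W(x, y) = x⁻¹ y`. -/
def building : Building cs W where
  toChamberSystem := cs.chamberSystem
  two_le_panel := by
    rintro σ ⟨i, c, rfl⟩
    have hsub : {c, c * cs.simple i} ⊆ cs.chamberSystem.residue {i} c := by
      rintro x (rfl | rfl)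
      · exact cs.chamberSystem.mem_residue_singleton.2 (Or.inl rfl)
      · exact cs.chamberSystem.mem_residue_singleton.2 (Or.inr rfl)
    rw [← Set.encard_pair (cs.self_ne_mul_simple i c)]
    exact Set.encard_le_encard hsub
  δ x y := x⁻¹ * y
  δ_eq_iff f _ x y := by
    rw [cs.chamberSystem_gallery_iff, inv_mul_eq_iff_eq_mul]

/-- The wall `M_r = {{c₁, c₂} : c₁, c₂ ∈ W are adjacent and r c₁ = c₂}` of a reflection `r` of `W`,
as a set of panels of `W`. -/
def wall (r : W) : Set (Set W) :=
  {P | ∃ c₁ c₂ : W, cs.building.Adjacent c₁ c₂ ∧ r * c₁ = c₂ ∧ P = {c₁, c₂}}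

end CoxeterSystem

namespace Building

variable {S W Δ : Type*} [Group W] {M : CoxeterMatrix S} {cs : CoxeterSystem M W}
  (D : Building cs Δ)

/-- The map `α`, restricted to the subset `X` of `W`, is an isometry `X → Δ`: it preserves the
`W`-distance. The values of `α` outside `X` are irrelevant. -/
def IsIsometryOn (X : Set W) (α : W → Δ) : Prop :=
  ∀ x ∈ X, ∀ y ∈ X, D.δ (α x) (α y) = cs.building.δ x y

/-- An apartment is the image of an isometry `W → Δ`. -/
def IsApartment (A : Set Δ) : Prop :=
  ∃ α : W → Δ, D.IsIsometryOn Set.univ α ∧ A = α '' Set.univ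

/-- `Ω`, a set of panels of `A`, is a wall in the apartment `A`: it is the image of a wall `M_r` of
`W` (`r` a reflection) under an isometry to `A` from the set of chambers contained in the panels
of `M_r`. -/
def IsWallIn (A : Set Δ) (Ω : Set (Set Δ)) : Prop :=
  ∃ r : W, cs.IsReflection r ∧ ∃ α : W → Δ, D.IsIsometryOn (⋃₀ cs.wall r) α ∧
    α '' (⋃₀ cs.wall r) ⊆ A ∧ Ω = (fun P : Set W => α '' P) '' cs.wall r

/-- A panel `P` of an apartment is branching if the panel of the building that contains it is
branching, that is, has degree (number of chambers, possibly infinite) at least 3. -/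
def IsBranching (P : Set Δ) : Prop :=
  ∃ σ : Set Δ, D.IsPanel σ ∧ P ⊆ σ ∧ 3 ≤ σ.encard

end Building

/-!
Let `P = {c, cs}` and `Q = {d, dt}` be panels of `M_r`, with `c` the chamber of `P` nearer to `d`,
and put `w = c⁻¹d`. Since `cs = rc` and `dt = rd`, we have `sw = wt`, and this element is longer
than `w`. If `e` is a third chamber in the panel of `α(P)`, then `e` has distance `sw = wt` to both
`α(d)` and `α(dt)`. A geodesic from `e` to `α(d)` of type `wt` enters the panel of `α(Q)` in a
chamber at distance `w` from `e`, which is therefore neither `α(d)` nor `α(dt)`.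
-/

theorem three_le_encard_iff_exists_ne {C : Type*} {σ : Set C} {x y : C} (hx : x ∈ σ) (hy : y ∈ σ)
    (hne : x ≠ y) : 3 ≤ σ.encard ↔ ∃ e ∈ σ, e ≠ x ∧ e ≠ y := by
  have hcard : (σ \ {x, y}).encard + 2 = σ.encard := by
    rw [← Set.encard_pair hne, Set.encard_sdiff_add_encard_of_subset (Set.pair_subset hx hy)]
  have hthree : (3 : ℕ∞) = 1 + 2 := by norm_num
  rw [← hcard, hthree, ENat.add_le_add_iff_right (by simp), Set.one_le_encard_iff_nonempty]
  simp only [Set.Nonempty, Set.mem_sdiff, Set.mem_insert_iff, Set.mem_singleton_iff, not_or]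

namespace ChamberSystem

variable {I C : Type*} {X : ChamberSystem I C}

theorem gallery_singleton_iff {i : I} {x y : C} :
    X.Gallery x [i] y ↔ X.adj i x y ∧ x ≠ y := by
  constructor
  · rintro (_ | ⟨hadj, hne, ⟨⟩⟩)
    exact ⟨hadj, hne⟩
  · rintro ⟨hadj, hne⟩
    exact .cons hadj hne (.nil y)

theorem gallery_append_iff {f g : List I} {x z : C} :
    X.Gallery x (f ++ g) z ↔ ∃ y, X.Gallery x f y ∧ X.Gallery y g z := by
  constructor
  · intro h
    induction f generalizing x with
    | nil => exact ⟨x, .nil x, h⟩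
    | cons i f ih =>
      rcases h with _ | ⟨hadj, hne, h⟩
      obtain ⟨y, hf, hg⟩ := ih h
      exact ⟨y, .cons hadj hne hf, hg⟩
  · rintro ⟨y, hf, hg⟩
    induction hf with
    | nil => exact hg
    | cons hadj hne _ ih => exact .cons hadj hne (ih hg)

theorem residue_singleton_eq_of_mem {i : I} {c x : C} (hx : x ∈ X.residue {i} c) :
    X.residue {i} c = X.residue {i} x := by
  have hcx := X.mem_residue_singleton.1 hx
  ext y
  rw [mem_residue_singleton, mem_residue_singleton]
  exact ⟨(X.adj i).trans ((X.adj i).symm hcx), (X.adj i).trans hcx⟩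

end ChamberSystem

namespace Building

variable {S W Δ : Type*} [Group W] {M : CoxeterMatrix S} {cs : CoxeterSystem M W}
  (D : Building cs Δ)

theorem δ_eq_simple_iff {s : S} {x y : Δ} :
    D.δ x y = cs.simple s ↔ D.adj s x y ∧ x ≠ y := by
  rw [← cs.wordProd_singleton, D.δ_eq_iff [s] (by simp [CoxeterSystem.IsReduced]),
    ChamberSystem.gallery_singleton_iff]

theorem mem_residue_singleton_iff_δ {s : S} {x y : Δ} :
    y ∈ D.residue {s} x ↔ y = x ∨ D.δ y x = cs.simple s := by
  rw [D.mem_residue_singleton, δ_eq_simple_iff]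
  constructor
  · intro hadj
    exact or_iff_not_imp_left.2 fun hne => ⟨(D.adj s).symm hadj, hne⟩
  · rintro (rfl | ⟨hadj, -⟩)
    exacts [(D.adj s).refl y, (D.adj s).symm hadj]

theorem δ_eq_mul_iff {u v : W} (hlen : cs.length (u * v) = cs.length u + cs.length v) {x z : Δ} :
    D.δ x z = u * v ↔ ∃ y, D.δ x y = u ∧ D.δ y z = v := by
  obtain ⟨f, hf, rfl⟩ := cs.exists_isReduced u
  obtain ⟨g, hg, rfl⟩ := cs.exists_isReduced v
  have hfg : cs.IsReduced (f ++ g) := by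
    rw [CoxeterSystem.IsReduced, cs.wordProd_append, hlen, hf.eq, hg.eq, List.length_append]
  simp only [← cs.wordProd_append, D.δ_eq_iff _ hfg, D.δ_eq_iff _ hf, D.δ_eq_iff _ hg,
    ChamberSystem.gallery_append_iff]

variable {D}

theorem eq_residue_singleton_of_isPanel {σ : Set Δ} (hσ : D.IsPanel σ) {s : S} {x x' : Δ}
    (hx : x ∈ σ) (hx' : x' ∈ σ) (h : D.δ x x' = cs.simple s) : σ = D.residue {s} x := by
  obtain ⟨i, c, rfl⟩ := hσ
  rw [ChamberSystem.residue_singleton_eq_of_mem hx] at hx' ⊢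
  have his : cs.simple s = cs.simple i :=
    h.symm.trans (D.δ_eq_simple_iff.2 ⟨D.mem_residue_singleton.1 hx', (D.δ_eq_simple_iff.1 h).2⟩)
  ext y
  rw [mem_residue_singleton_iff_δ, mem_residue_singleton_iff_δ, his]

theorem isBranching_pair_iff_three_le_encard {s : S} {x x' : Δ} (h : D.δ x x' = cs.simple s) :
    D.IsBranching {x, x'} ↔ 3 ≤ (D.residue {s} x).encard := by
  constructor
  · rintro ⟨σ, hσ, hsub, hcard⟩
    obtain ⟨hx, hx'⟩ := Set.pair_subset_iff.1 hsub
    rwa [← eq_residue_singleton_of_isPanel hσ hx hx' h]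
  · intro hcard
    have hx : x ∈ D.residue {s} x := D.mem_residue_singleton_iff_δ.2 (.inl rfl)
    have hx' : x' ∈ D.residue {s} x := D.mem_residue_singleton.2 (D.δ_eq_simple_iff.1 h).1
    exact ⟨_, ⟨s, x, rfl⟩, Set.pair_subset hx hx', hcard⟩

theorem isBranching_pair_iff_exists {s : S} {x x' : Δ} (h : D.δ x x' = cs.simple s) :
    D.IsBranching {x, x'} ↔ ∃ e, D.δ e x = cs.simple s ∧ D.δ e x' = cs.simple s := by
  obtain ⟨hadj, hne⟩ := D.δ_eq_simple_iff.1 h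
  rw [isBranching_pair_iff_three_le_encard h, three_le_encard_iff_exists_ne
    (D.mem_residue_singleton_iff_δ.2 (.inl rfl)) (D.mem_residue_singleton.2 hadj) hne]
  refine exists_congr fun e => ?_
  rw [D.mem_residue_singleton, δ_eq_simple_iff, δ_eq_simple_iff]
  constructor
  · rintro ⟨hxe, hex, hex'⟩
    have hadj_e := (D.adj s).symm hxe
    exact ⟨⟨hadj_e, hex⟩, (D.adj s).trans hadj_e hadj, hex'⟩
  · rintro ⟨⟨hadj_e, hex⟩, -, hex'⟩
    exact ⟨(D.adj s).symm hadj_e, hex, hex'⟩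

theorem IsBranching.of_parallel {s t : S} {w : W} {x x' y y' : Δ}
    (hsw : cs.simple s * w = w * cs.simple t) (hlen : ¬ cs.IsLeftDescent w s)
    (hxx' : D.δ x x' = cs.simple s) (hyy' : D.δ y y' = cs.simple t)
    (hxy : D.δ x y = w) (hxy' : D.δ x' y' = w) (hb : D.IsBranching {x, x'}) :
    D.IsBranching {y, y'} := by
  have hlen_sw : cs.length (cs.simple s * w) = cs.length (cs.simple s) + cs.length w := by
    rw [cs.not_isLeftDescent_iff.1 hlen, cs.length_simple, add_comm]
  have hlen_wt : cs.length (w * cs.simple t) = cs.length w + cs.length (cs.simple t) := by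
    rw [← hsw, hlen_sw, cs.length_simple, cs.length_simple, add_comm]
  obtain ⟨e, hex, hex'⟩ := (isBranching_pair_iff_exists hxx').1 hb
  have hey : D.δ e y = cs.simple s * w := (D.δ_eq_mul_iff hlen_sw).2 ⟨x, hex, hxy⟩
  have hey' : D.δ e y' = cs.simple s * w := (D.δ_eq_mul_iff hlen_sw).2 ⟨x', hex', hxy'⟩
  obtain ⟨z, hez, hzy⟩ := (D.δ_eq_mul_iff hlen_wt).1 (hey.trans hsw)
  have hzy'_ne : z ≠ y' := by
    rintro rfl
    exact cs.length_simple_mul_ne w s (congrArg cs.length (hey'.symm.trans hez))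
  have hzy'_adj : D.adj t z y' :=
    (D.adj t).trans (D.δ_eq_simple_iff.1 hzy).1 (D.δ_eq_simple_iff.1 hyy').1
  exact (isBranching_pair_iff_exists hyy').2 ⟨z, hzy, D.δ_eq_simple_iff.2 ⟨hzy'_adj, hzy'_ne⟩⟩

theorem IsIsometryOn.mono {X Y : Set W} {α : W → Δ} (hα : D.IsIsometryOn Y α) (hXY : X ⊆ Y) :
    D.IsIsometryOn X α :=
  fun x hx y hy => hα x (hXY hx) y (hXY hy)

theorem IsIsometryOn.δ_apply {X : Set W} {α : W → Δ} (hα : D.IsIsometryOn X α) {x y : W}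
    (hx : x ∈ X) (hy : y ∈ X) : D.δ (α x) (α y) = x⁻¹ * y :=
  hα x hx y hy

end Building

section Wall

variable {S W : Type*} [Group W] {M : CoxeterMatrix S} {cs : CoxeterSystem M W} {r : W} {P : Set W}

theorem exists_simple_of_mem_wall (hr : r ≠ 1) (hP : P ∈ cs.wall r) :
    ∃ c s, SemiconjBy c (cs.simple s) r ∧ P = {c, c * cs.simple s} := by
  obtain ⟨c₁, c₂, ⟨s, h | h⟩, hrc, rfl⟩ := hP
  · exact absurd (mul_eq_right.1 (hrc.trans h)) hr
  · exact ⟨c₁, s, (hrc.trans h).symm, by rw [h]⟩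

theorem exists_not_isLeftDescent_of_mem_wall (hr : r ≠ 1) (hP : P ∈ cs.wall r) (d : W) :
    ∃ c s, SemiconjBy c (cs.simple s) r ∧ P = {c, c * cs.simple s} ∧
      ¬ cs.IsLeftDescent (c⁻¹ * d) s := by
  obtain ⟨c, s, hc, hPc⟩ := exists_simple_of_mem_wall hr hP
  by_cases hlen : cs.IsLeftDescent (c⁻¹ * d) s
  · refine ⟨c * cs.simple s, s, hc.mul_left (Commute.refl _), ?_, ?_⟩
    · rw [hPc, cs.simple_mul_simple_cancel_right, Set.pair_comm]
    · rw [mul_inv_rev, cs.inv_simple, mul_assoc]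
      exact cs.isLeftDescent_iff_not_isLeftDescent_mul.1 hlen
  · exact ⟨c, s, hc, hPc, hlen⟩

end Wall

theorem lemma3p5_general {S W Δ : Type*} [Group W] {M : CoxeterMatrix S} {cs : CoxeterSystem M W}
    {D : Building cs Δ} {r : W} (hr : cs.IsReflection r) {P Q : Set W} (hP : P ∈ cs.wall r)
    (hQ : Q ∈ cs.wall r) {α : W → Δ} (hα : D.IsIsometryOn (P ∪ Q) α)
    (hbranch : D.IsBranching (α '' P)) : D.IsBranching (α '' Q) := by
  have hr_ne : r ≠ 1 := by
    rintro rfl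
    simpa using hr.odd_length
  obtain ⟨d, t, hd, rfl⟩ := exists_simple_of_mem_wall hr_ne hQ
  obtain ⟨c, s, hc, rfl, hlen⟩ := exists_not_isLeftDescent_of_mem_wall hr_ne hP d
  have hsw : cs.simple s * (c⁻¹ * d) = c⁻¹ * d * cs.simple t :=
    (hc.inv_symm_left.mul_left hd).eq.symm
  have hcd : (c * cs.simple s)⁻¹ * (d * cs.simple t) = c⁻¹ * d := by
    rw [hc.eq, hd.eq, mul_inv_rev, mul_assoc, inv_mul_cancel_left]
  rw [Set.image_pair] at hbranch ⊢
  refine hbranch.of_parallel hsw hlen ?_ ?_ (hα.δ_apply (by simp) (by simp)) ?_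
  · rw [hα.δ_apply (by simp) (by simp), inv_mul_cancel_left]
  · rw [hα.δ_apply (by simp) (by simp), inv_mul_cancel_left]
  · rw [hα.δ_apply (by simp) (by simp), hcd]

theorem lemma3p5 {S W Δ : Type*} [Group W] {M : CoxeterMatrix S} (cs : CoxeterSystem M W)
    (D : Building cs Δ) (A : Set Δ) (hA : D.IsApartment A)
    (Ω : Set (Set Δ)) (hΩ : D.IsWallIn A Ω)
    (hbranch : ∃ P ∈ Ω, D.IsBranching P) :
    ∀ P ∈ Ω, D.IsBranching P := by
  obtain ⟨⟨r, hr, α, hα, -, rfl⟩, _, ⟨P, hP, rfl⟩, hPbranch⟩ := hΩ, hbranch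
  rintro _ ⟨Q, hQ, rfl⟩
  have hPQ : P ∪ Q ⊆ ⋃₀ cs.wall r :=
    Set.union_subset (Set.subset_sUnion_of_mem hP) (Set.subset_sUnion_of_mem hQ)
  exact lemma3p5_general hr hP hQ (hα.mono hPQ) hPbranch
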